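/- Let $\beta>0$ and $\rho>0$. Relays are placed sequentially along a line whose length is exponentially distributed with mean $1/\beta$. The non-terminal states are the $s\in(0,1]$; there is an absorbing, cost-free state $\mathbf e$ (the line has ended). In a state $s_n\in(0,1]$ an action $a_n\in[0,\infty]$ is chosen, namely the distance from the current placement point at which the next relay is to be placed ($a_n=\infty$: no further relay). Let $l_n$ be the residual length of the line at that point, and let $\xi>0$ be the cost of a relay. If $l_n>a_n$, a relay is placed, the cost $$c(s_n,a_n,l_n)=\xi+s_n(e^{\rho a_n}-1)$$ is incurred, and $$s_{n+1}=\frac{s_ne^{\rho a_n}}{1+s_ne^{\rho a_n}},\qquad l_{n+1}=l_n-a_n .$$ If $l_n\le a_n$, the line ends, the cost $c(s_n,a_n,l_n)=s_n(e^{\rho l_n}-1)$ is incurred, and $s_{n+1}=\mathbf e$. A policy $\pi\in\Pi$ is a sequence of measurable maps giving $a_n$ as a function of the states $s_0,\dots,s_n$ and the distances $a_0,\dots,a_{n-1}$ at which relays were placed. For $s\in(0,1]$ let $$J_\xi(s)=\inf_{\pi\in\Pi}\mathbb E_\pi\Big(\sum_{n=0}^{\infty}c(s_n,a_n,l_n)\,\Big|\,s_0=s\Big),$$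 where $l_0$ is exponentially distributed with mean $1/\beta$ and $c(\mathbf e,\cdot,\cdot)=0$. Then $J_\xi(s)<\infty$ for all $\xi>0$ and $s\in(0,1]$, and: 1. for every $s\in(0,1]$, $\xi\mapsto J_\xi(s)$ is increasing (in the weak sense, i.e. nondecreasing) and concave on $(0,\infty)$; 2. for every $\xi>0$, $s\mapsto J_\xi(s)$ is continuous on $(0,1]$; 3. for every $s\in(0,1]$, $\xi\mapsto J_\xi(s)$ is continuous on $(0,\infty)$. -/

import Mathlib

open scoped ENNReal NNReal

noncomputable section

namespace RelayPlacement

/-- The non-terminal states of the decision process: the interval `(0, 1]`.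
The termination state (end of the line) is represented by `none` in `run` below. -/
abbrev LiveState : Type := Set.Ioc (0 : ℝ) 1

theorem next_mem (ρ : ℝ) (s : LiveState) (r : ℝ≥0) :
    (s : ℝ) * Real.exp (ρ * r) / (1 + (s : ℝ) * Real.exp (ρ * r)) ∈ Set.Ioc (0 : ℝ) 1 := by
  have hs : 0 < (s : ℝ) * Real.exp (ρ * r) := mul_pos s.2.1 (Real.exp_pos _)
  refine ⟨by positivity, ?_⟩
  rw [div_le_one (by positivity)]
  linarith

/-- The state after a relay has been placed at distance `r` from the current placement point:
`s ↦ s e^{ρ r} / (1 + s e^{ρ r})`. -/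
def next (ρ : ℝ) (s : LiveState) (r : ℝ≥0) : LiveState :=
  ⟨(s : ℝ) * Real.exp (ρ * r) / (1 + (s : ℝ) * Real.exp (ρ * r)), next_mem ρ s r⟩

/-- The single-stage cost in state `s`, with action `a ∈ [0, ∞]` and residual line length `l`:
`ξ + s (e^{ρ a} - 1)` if `l > a` (a relay is placed), and `s (e^{ρ l} - 1)` if `l ≤ a`
(the line ends first and the sink is placed). The action `∞` places no further relay. -/
def stageCost (ρ ξ : ℝ) (s : LiveState) (a : ℝ≥0∞) (l : ℝ) : ℝ :=
  if a < ENNReal.ofReal l then ξ + (s : ℝ) * (Real.exp (ρ * a.toReal) - 1)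
  else (s : ℝ) * (Real.exp (ρ * l) - 1)

/-- What is known at decision instant `k` if the line has not ended before it:
the states `s_0, …, s_k` and the distances between the successive relays placed so far. -/
abbrev History (k : ℕ) : Type := (Fin (k + 1) → LiveState) × (Fin k → ℝ≥0)

/-- A deployment policy: a sequence of measurable maps which prescribe, from the history, the
distance in `[0, ∞]` at which the next relay is to be placed. No action is taken once the line
has ended. -/
structure Policy where
  act : (k : ℕ) → History k → ℝ≥0∞
  measurable_act : ∀ k, Measurable (act k)

/-- The process under the policy `π`, started in state `s`, on a line of (residual) length `L`.
At decision instant `k` it is `some (h, l)` if the line has not ended, where `h` is the history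
and `l` the residual length of the line from the current placement point, and `none` if the
termination state has been reached. -/
def run (ρ : ℝ) (π : Policy) (s : LiveState) (L : ℝ) : (k : ℕ) → Option (History k × ℝ)
  | 0 => some ((fun _ => s, Fin.elim0), L)
  | k + 1 =>
    match run ρ π s L k with
    | none => none
    | some (h, l) =>
      if π.act k h < ENNReal.ofReal l then
        some ((Fin.snoc (α := fun _ => LiveState) h.1
                (next ρ (h.1 (Fin.last k)) (π.act k h).toNNReal),
              Fin.snoc (α := fun _ => ℝ≥0) h.2 (π.act k h).toNNReal),
          l - (π.act k h).toReal)
      else none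

/-- The cost incurred at decision instant `k`; it is zero in the termination state. -/
def costAt (ρ ξ : ℝ) (π : Policy) (s : LiveState) (L : ℝ) (k : ℕ) : ℝ≥0∞ :=
  match run ρ π s L k with
  | none => 0
  | some (h, l) => ENNReal.ofReal (stageCost ρ ξ (h.1 (Fin.last k)) (π.act k h) l)

/-- The expected total cost of the policy `π` from the state `s`, the residual length of the line
being exponentially distributed with mean `1 / β`. -/
def expectedCost (β ρ ξ : ℝ) (π : Policy) (s : LiveState) : ℝ≥0∞ :=
  ∫⁻ L, ∑' k, costAt ρ ξ π s L k ∂(ProbabilityTheory.expMeasure β)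

/-- The optimal value function `J_ξ(s)`, with values in `[0, ∞]`. -/
def J (β ρ ξ : ℝ) (s : LiveState) : ℝ≥0∞ :=
  ⨅ π : Policy, expectedCost β ρ ξ π s

end RelayPlacement

end

open scoped ENNReal NNReal

noncomputable section

namespace RelayPlacement

/-! The only randomness is the line length, and until the line ends it does not affect the history.
So from a fixed initial state every policy acts like a deterministic sequence of distances
(`J_eq_iInf_seq`).

Under one such sequence, two initial states `s ≤ t` share stopping stage and residual lengths, and
the bounds `s ≤ t ≤ c * s` propagate through the state update and the stage costs. Hence `J` is
nondecreasing in the state and `J t ≤ (t / s) * J s`; squeezing gives continuity in `s`.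

For a fixed policy the cost is affine and nondecreasing in `ξ`, so its infimum is nondecreasing and
concave; being finite on an open interval, it is continuous there. Finiteness comes from placing
relays at unit distance. -/

/-! ### Reduction to open-loop policies -/

/-- The open-loop policy that follows a fixed sequence of actions. -/
def Policy.ofSeq (a : ℕ → ℝ≥0∞) : Policy where
  act k _ := a k
  measurable_act _ := measurable_const

@[simp]
theorem Policy.ofSeq_act (a : ℕ → ℝ≥0∞) (k : ℕ) (h : History k) :
    (Policy.ofSeq a).act k h = a k := rfl

/-- The history under `π` from `s` as long as the line has not ended; it does not depend on the
length of the line. -/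
def liveHistory (ρ : ℝ) (π : Policy) (s : LiveState) : (k : ℕ) → History k
  | 0 => (fun _ => s, Fin.elim0)
  | k + 1 =>
    let h := liveHistory ρ π s k
    (Fin.snoc (α := fun _ => LiveState) h.1 (next ρ (h.1 (Fin.last k)) (π.act k h).toNNReal),
      Fin.snoc (α := fun _ => ℝ≥0) h.2 (π.act k h).toNNReal)

/-- The sequence of actions that `π` prescribes from `s` as long as the line has not ended. -/
def Policy.actions (ρ : ℝ) (π : Policy) (s : LiveState) (k : ℕ) : ℝ≥0∞ :=
  π.act k (liveHistory ρ π s k)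

theorem run_eq_none_or (ρ : ℝ) (π : Policy) (s : LiveState) (L : ℝ) (k : ℕ) :
    run ρ π s L k = none ∨ ∃ l, run ρ π s L k = some (liveHistory ρ π s k, l) := by
  induction k with
  | zero => exact Or.inr ⟨L, rfl⟩
  | succ k ih =>
    rcases ih with h | ⟨l, h⟩
    · left
      simp only [run, h]
    · simp only [run, h]
      split_ifs
      · exact Or.inr ⟨_, rfl⟩
      · exact Or.inl rfl

theorem run_ofSeq_actions (ρ : ℝ) (π : Policy) (s : LiveState) (L : ℝ) (k : ℕ) :
    run ρ (Policy.ofSeq (π.actions ρ s)) s L k = run ρ π s L k := by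
  induction k with
  | zero => rfl
  | succ k ih =>
    rcases run_eq_none_or ρ π s L k with h | ⟨l, h⟩
    · rw [h] at ih
      simp only [run, h, ih]
    · rw [h] at ih
      simp only [run, h, ih]
      rfl

theorem expectedCost_ofSeq_actions (β ρ ξ : ℝ) (π : Policy) (s : LiveState) :
    expectedCost β ρ ξ (Policy.ofSeq (π.actions ρ s)) s = expectedCost β ρ ξ π s := by
  unfold expectedCost
  congr 1
  ext L
  congr 1
  ext k
  unfold costAt
  rw [run_ofSeq_actions]
  rcases run_eq_none_or ρ π s L k with h | ⟨l, h⟩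
  · rw [h]
  · rw [h]
    rfl

theorem J_eq_iInf_seq (β ρ ξ : ℝ) (s : LiveState) :
    J β ρ ξ s = ⨅ a : ℕ → ℝ≥0∞, expectedCost β ρ ξ (Policy.ofSeq a) s := by
  refine le_antisymm (le_iInf fun a => iInf_le _ _) (le_iInf fun π => ?_)
  rw [← expectedCost_ofSeq_actions]
  exact iInf_le (fun a : ℕ → ℝ≥0∞ => expectedCost β ρ ξ (Policy.ofSeq a) s) _

/-! ### Dependence on the initial state -/

theorem next_mono (ρ : ℝ) (r : ℝ≥0) : Monotone fun s => next ρ s r := by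
  intro s t hst
  have hs := s.2.1
  have ht := t.2.1
  have hst' : (s : ℝ) ≤ t := hst
  have he := Real.exp_pos (ρ * r)
  change (s : ℝ) * Real.exp (ρ * r) / (1 + (s : ℝ) * Real.exp (ρ * r)) ≤
    (t : ℝ) * Real.exp (ρ * r) / (1 + (t : ℝ) * Real.exp (ρ * r))
  rw [div_le_div_iff₀ (by positivity) (by positivity)]
  nlinarith [mul_le_mul_of_nonneg_right hst' he.le]

/-- The map `x ↦ x / (1 + x)` has decreasing slope from the origin, so it does not enlarge ratios
above 1. -/
theorem next_le_mul_next (ρ : ℝ) (r : ℝ≥0) {s t : LiveState} {c : ℝ} (hc : 1 ≤ c)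
    (h : (t : ℝ) ≤ c * s) : (next ρ t r : ℝ) ≤ c * next ρ s r := by
  have hs := s.2.1
  have ht := t.2.1
  have he := Real.exp_pos (ρ * r)
  change (t : ℝ) * Real.exp (ρ * r) / (1 + (t : ℝ) * Real.exp (ρ * r)) ≤
    c * ((s : ℝ) * Real.exp (ρ * r) / (1 + (s : ℝ) * Real.exp (ρ * r)))
  rw [← mul_div_assoc, div_le_div_iff₀ (by positivity) (by positivity)]
  have h1 := mul_le_mul_of_nonneg_right h he.le
  have h2 : 0 ≤ (s : ℝ) * Real.exp (ρ * r) * ((t : ℝ) * Real.exp (ρ * r)) := by positivity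
  nlinarith [mul_le_mul_of_nonneg_right hc h2]

theorem run_ofSeq_compare (ρ : ℝ) (a : ℕ → ℝ≥0∞) {s t : LiveState} {c : ℝ} (hc : 1 ≤ c)
    (hst : s ≤ t) (hts : (t : ℝ) ≤ c * s) (L : ℝ) (k : ℕ) :
    (run ρ (Policy.ofSeq a) s L k = none ∧ run ρ (Policy.ofSeq a) t L k = none) ∨
    ∃ h h' l, run ρ (Policy.ofSeq a) s L k = some (h, l) ∧
      run ρ (Policy.ofSeq a) t L k = some (h', l) ∧
      h.1 (Fin.last k) ≤ h'.1 (Fin.last k) ∧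
      (h'.1 (Fin.last k) : ℝ) ≤ c * h.1 (Fin.last k) := by
  induction k with
  | zero => exact Or.inr ⟨_, _, _, rfl, rfl, hst, hts⟩
  | succ k ih =>
    rcases ih with ⟨h1, h2⟩ | ⟨h, h', l, h1, h2, h3, h4⟩
    · left
      simp only [run, h1, h2, and_self]
    · simp only [run, h1, h2]
      by_cases hl : a k < ENNReal.ofReal l
      · right
        refine ⟨_, _, _, if_pos hl, if_pos hl, ?_, ?_⟩
        · simpa only [Fin.snoc_last, Policy.ofSeq_act] using next_mono ρ (a k).toNNReal h3
        · simpa only [Fin.snoc_last, Policy.ofSeq_act] using next_le_mul_next ρ (a k).toNNReal hc h4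
      · exact Or.inl ⟨if_neg hl, if_neg hl⟩

theorem ofReal_stageCost (ρ : ℝ) {ξ : ℝ} (hρ : 0 ≤ ρ) (hξ : 0 ≤ ξ) (s : LiveState) (a : ℝ≥0∞)
    (l : ℝ) : ENNReal.ofReal (stageCost ρ ξ s a l) =
      if a < ENNReal.ofReal l then
        ENNReal.ofReal ξ + ENNReal.ofReal s * ENNReal.ofReal (Real.exp (ρ * a.toReal) - 1)
      else ENNReal.ofReal s * ENNReal.ofReal (Real.exp (ρ * l) - 1) := by
  have hs := s.2.1.le
  unfold stageCost
  split_ifs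
  · have h : 0 ≤ Real.exp (ρ * a.toReal) - 1 :=
      sub_nonneg.2 (Real.one_le_exp (mul_nonneg hρ ENNReal.toReal_nonneg))
    rw [ENNReal.ofReal_add hξ (mul_nonneg hs h), ENNReal.ofReal_mul hs]
  · rw [ENNReal.ofReal_mul hs]

/-- Each stage cost is affine in the state with nonnegative coefficients, and the constant term `ξ`
is absorbed because `c ≥ 1`. -/
theorem costAt_ofSeq_compare {ρ ξ : ℝ} (hρ : 0 ≤ ρ) (hξ : 0 ≤ ξ) (a : ℕ → ℝ≥0∞)
    {s t : LiveState} {c : ℝ} (hc : 1 ≤ c) (hst : s ≤ t) (hts : (t : ℝ) ≤ c * s)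
    (L : ℝ) (k : ℕ) :
    costAt ρ ξ (Policy.ofSeq a) s L k ≤ costAt ρ ξ (Policy.ofSeq a) t L k ∧
    costAt ρ ξ (Policy.ofSeq a) t L k ≤
      ENNReal.ofReal c * costAt ρ ξ (Policy.ofSeq a) s L k := by
  unfold costAt
  rcases run_ofSeq_compare ρ a hc hst hts L k with ⟨h1, h2⟩ | ⟨h, h', l, h1, h2, h3, h4⟩
  · simp [h1, h2]
  · simp only [h1, h2, ofReal_stageCost ρ hρ hξ, Policy.ofSeq_act]
    have h3' : ENNReal.ofReal (h.1 (Fin.last k)) ≤ ENNReal.ofReal (h'.1 (Fin.last k)) :=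
      ENNReal.ofReal_le_ofReal h3
    have h4' : ENNReal.ofReal (h'.1 (Fin.last k)) ≤
        ENNReal.ofReal c * ENNReal.ofReal (h.1 (Fin.last k)) := by
      rw [← ENNReal.ofReal_mul (by linarith)]
      exact ENNReal.ofReal_le_ofReal h4
    have hc' : 1 ≤ ENNReal.ofReal c := ENNReal.one_le_ofReal.2 hc
    split_ifs
    · refine ⟨by gcongr, ?_⟩
      rw [mul_add, ← mul_assoc]
      gcongr
      exact le_mul_of_one_le_left' hc'
    · refine ⟨by gcongr, ?_⟩
      rw [← mul_assoc]
      gcongr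

theorem J_mono_state (β : ℝ) {ρ ξ : ℝ} (hρ : 0 ≤ ρ) (hξ : 0 ≤ ξ) : Monotone (J β ρ ξ) := by
  intro s t hst
  have hs := s.2.1
  have hst' : (s : ℝ) ≤ t := hst
  simp only [J_eq_iInf_seq]
  refine iInf_mono fun a => MeasureTheory.lintegral_mono fun L => ENNReal.tsum_le_tsum fun k => ?_
  exact (costAt_ofSeq_compare hρ hξ a ((one_le_div hs).2 hst') hst
    (div_mul_cancel₀ _ hs.ne').ge L k).1

theorem J_le_mul_J (β : ℝ) {ρ ξ : ℝ} (hρ : 0 ≤ ρ) (hξ : 0 ≤ ξ) {s t : LiveState} (hst : s ≤ t) :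
    J β ρ ξ t ≤ ENNReal.ofReal (t / s) * J β ρ ξ s := by
  have hs := s.2.1
  have ht := t.2.1
  have hst' : (s : ℝ) ≤ t := hst
  simp only [J_eq_iInf_seq]
  rw [ENNReal.mul_iInf_of_ne (ENNReal.ofReal_pos.2 (by positivity)).ne' ENNReal.ofReal_ne_top]
  refine iInf_mono fun a => ?_
  unfold expectedCost
  rw [← MeasureTheory.lintegral_const_mul' _ _ ENNReal.ofReal_ne_top]
  refine MeasureTheory.lintegral_mono fun L => ?_
  simp only [← ENNReal.tsum_mul_left]
  exact ENNReal.tsum_le_tsum fun k => (costAt_ofSeq_compare hρ hξ a ((one_le_div hs).2 hst') hst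
    (div_mul_cancel₀ _ hs.ne').ge L k).2

/-! ### Dependence on the relay cost -/

theorem costAt_mono_relayCost (ρ : ℝ) (π : Policy) (s : LiveState) (L : ℝ) (k : ℕ) :
    Monotone fun ξ => costAt ρ ξ π s L k := by
  intro ξ η h
  simp only [costAt]
  cases run ρ π s L k with
  | none => exact le_rfl
  | some p =>
    refine ENNReal.ofReal_le_ofReal ?_
    unfold stageCost
    split_ifs <;> linarith

theorem J_mono_relayCost (β ρ : ℝ) (s : LiveState) : Monotone fun ξ => J β ρ ξ s :=
  fun _ _ h => iInf_mono fun π => MeasureTheory.lintegral_mono fun L =>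
    ENNReal.tsum_le_tsum fun k => costAt_mono_relayCost ρ π s L k h

theorem costAt_convexComb {ρ ξ η p q : ℝ} (hρ : 0 ≤ ρ) (hξ : 0 ≤ ξ) (hη : 0 ≤ η) (hp : 0 ≤ p)
    (hq : 0 ≤ q) (hpq : p + q = 1) (π : Policy) (s : LiveState) (L : ℝ) (k : ℕ) :
    ENNReal.ofReal p * costAt ρ ξ π s L k + ENNReal.ofReal q * costAt ρ η π s L k =
      costAt ρ (p * ξ + q * η) π s L k := by
  have hone : ENNReal.ofReal p + ENNReal.ofReal q = 1 := by
    rw [← ENNReal.ofReal_add hp hq, hpq, ENNReal.ofReal_one]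
  unfold costAt
  cases run ρ π s L k with
  | none => simp
  | some x =>
    simp only [ofReal_stageCost ρ hρ hξ, ofReal_stageCost ρ hρ hη,
      ofReal_stageCost ρ hρ (add_nonneg (mul_nonneg hp hξ) (mul_nonneg hq hη))]
    split_ifs
    · rw [ENNReal.ofReal_add (mul_nonneg hp hξ) (mul_nonneg hq hη), ENNReal.ofReal_mul hp,
        ENNReal.ofReal_mul hq, mul_add, mul_add, add_add_add_comm, ← add_mul, hone, one_mul]
    · rw [← add_mul, hone, one_mul]

theorem J_concave_relayCost (β : ℝ) {ρ ξ η p q : ℝ} (hρ : 0 ≤ ρ) (hξ : 0 ≤ ξ) (hη : 0 ≤ η)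
    (hp : 0 ≤ p) (hq : 0 ≤ q) (hpq : p + q = 1) (s : LiveState) :
    ENNReal.ofReal p * J β ρ ξ s + ENNReal.ofReal q * J β ρ η s ≤ J β ρ (p * ξ + q * η) s := by
  refine le_iInf fun π => ?_
  calc ENNReal.ofReal p * J β ρ ξ s + ENNReal.ofReal q * J β ρ η s
      ≤ ENNReal.ofReal p * expectedCost β ρ ξ π s + ENNReal.ofReal q * expectedCost β ρ η π s := by
        gcongr <;> exact iInf_le _ _
    _ ≤ expectedCost β ρ (p * ξ + q * η) π s := by
        unfold expectedCost
        rw [← MeasureTheory.lintegral_const_mul' _ _ ENNReal.ofReal_ne_top,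
          ← MeasureTheory.lintegral_const_mul' _ _ ENNReal.ofReal_ne_top]
        -- Superadditivity of the lower integral suffices, and it needs no measurability of the cost
        -- in `L`.
        refine (MeasureTheory.le_lintegral_add _ _).trans_eq ?_
        congr 1
        ext L
        rw [← ENNReal.tsum_mul_left, ← ENNReal.tsum_mul_left, ← ENNReal.tsum_add]
        exact tsum_congr fun k => costAt_convexComb hρ hξ hη hp hq hpq π s L k

/-! ### Finiteness, from relays at unit distance -/

theorem run_ofSeq_one_residual (ρ : ℝ) (s : LiveState) (L : ℝ) (k : ℕ) {h : History k} {l : ℝ}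
    (hr : run ρ (Policy.ofSeq 1) s L k = some (h, l)) : l = L - k := by
  induction k generalizing l with
  | zero =>
    simp only [run, Option.some.injEq, Prod.mk.injEq] at hr
    simp [hr.2]
  | succ k ih =>
    rcases hk : run ρ (Policy.ofSeq 1) s L k with _ | ⟨h', l'⟩
    · simp [run, hk] at hr
    · simp only [run, hk] at hr
      split_ifs at hr
      simp only [Option.some.injEq, Prod.mk.injEq] at hr
      rw [← hr.2, ih hk]
      simp [Policy.ofSeq]
      ring

/-- Stage `k` is reached at a positive residual only if `L > k`, and it covers at most unit distance
from a state at most 1. Since `L > k` has probability `exp (-β k)`, the bounds sum geometrically. -/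
theorem costAt_ofSeq_one_le {ρ ξ : ℝ} (hρ : 0 ≤ ρ) (hξ : 0 ≤ ξ) (s : LiveState) (L : ℝ) (k : ℕ) :
    costAt ρ ξ (Policy.ofSeq 1) s L k ≤
      (Set.Ioi (k : ℝ)).indicator (fun _ => ENNReal.ofReal (ξ + Real.exp ρ)) L := by
  unfold costAt
  rcases hk : run ρ (Policy.ofSeq 1) s L k with _ | ⟨h, l⟩
  · simp
  · have hl := run_ofSeq_one_residual ρ s L k hk
    have hx := (h.1 (Fin.last k)).2
    set x : ℝ := ((h.1 (Fin.last k) : LiveState) : ℝ) with hx_def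
    simp only [stageCost, Policy.ofSeq_act, Pi.one_apply, ← hx_def, ENNReal.toReal_one, mul_one]
    have he := Real.one_le_exp hρ
    by_cases hL : (k : ℝ) < L
    · rw [Set.indicator_of_mem (Set.mem_Ioi.2 hL)]
      refine ENNReal.ofReal_le_ofReal ?_
      split_ifs with h1
      · nlinarith [hx.1, hx.2]
      · have hl1 : l ≤ 1 := by
          rw [not_lt, ← ENNReal.ofReal_one] at h1
          exact (ENNReal.ofReal_le_ofReal_iff zero_le_one).1 h1
        have hle : Real.exp (ρ * l) ≤ Real.exp ρ := Real.exp_le_exp.2 (by nlinarith)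
        nlinarith [hx.1, hx.2]
    · rw [Set.indicator_of_notMem (by simpa using hL)]
      -- This can happen only for `k = 0` and `L ≤ 0`; the real cost is then nonpositive and
      -- `ENNReal.ofReal` truncates it to 0.
      have hl0 : l ≤ 0 := by linarith
      rw [if_neg (by simp [ENNReal.ofReal_of_nonpos hl0]), ENNReal.ofReal_of_nonpos]
      have hle : Real.exp (ρ * l) ≤ 1 := Real.exp_le_one_iff.2 (mul_nonpos_of_nonneg_of_nonpos hρ hl0)
      nlinarith [hx.1]

theorem expMeasure_Ioi {β : ℝ} (hβ : 0 < β) {x : ℝ} (hx : 0 ≤ x) :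
    ProbabilityTheory.expMeasure β (Set.Ioi x) = ENNReal.ofReal (Real.exp (-(β * x))) := by
  have := ProbabilityTheory.isProbabilityMeasure_expMeasure hβ
  have hc := ProbabilityTheory.cdf_expMeasure_eq hβ x
  rw [if_pos hx, ProbabilityTheory.cdf_eq_real] at hc
  rw [← Set.compl_Iic, ← MeasureTheory.ofReal_measureReal,
    MeasureTheory.probReal_compl_eq_one_sub measurableSet_Iic, hc]
  ring_nf

theorem J_lt_top {β ρ ξ : ℝ} (hβ : 0 < β) (hρ : 0 ≤ ρ) (hξ : 0 ≤ ξ) (s : LiveState) :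
    J β ρ ξ s < ⊤ := by
  refine (iInf_le _ (Policy.ofSeq 1)).trans_lt ?_
  have hr : Real.exp (-β) < 1 := Real.exp_lt_one_iff.2 (by linarith)
  calc expectedCost β ρ ξ (Policy.ofSeq 1) s
      ≤ ∫⁻ L, ∑' k : ℕ, (Set.Ioi (k : ℝ)).indicator (fun _ => ENNReal.ofReal (ξ + Real.exp ρ)) L
          ∂(ProbabilityTheory.expMeasure β) :=
        MeasureTheory.lintegral_mono fun L =>
          ENNReal.tsum_le_tsum fun k => costAt_ofSeq_one_le hρ hξ s L k
    _ = ∑' k : ℕ, ENNReal.ofReal (ξ + Real.exp ρ) * ENNReal.ofReal (Real.exp (-β)) ^ k := by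
        rw [MeasureTheory.lintegral_tsum fun k =>
          (measurable_const.indicator measurableSet_Ioi).aemeasurable]
        refine tsum_congr fun k => ?_
        rw [MeasureTheory.lintegral_indicator_const measurableSet_Ioi,
          expMeasure_Ioi hβ k.cast_nonneg, ← ENNReal.ofReal_pow (Real.exp_pos _).le,
          ← Real.exp_nat_mul]
        ring_nf
    _ < ⊤ := by
        rw [ENNReal.tsum_mul_left, ENNReal.tsum_geometric]
        refine ENNReal.mul_lt_top ENNReal.ofReal_lt_top (ENNReal.inv_lt_top.2 ?_)
        exact tsub_pos_of_lt (ENNReal.ofReal_lt_one.2 hr)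

/-! ### Continuity and concavity of the real-valued function -/

theorem continuous_J_toReal {β ρ ξ : ℝ} (hβ : 0 < β) (hρ : 0 ≤ ρ) (hξ : 0 ≤ ξ) :
    Continuous fun s : LiveState => (J β ρ ξ s).toReal := by
  have hmono : Monotone fun s : LiveState => (J β ρ ξ s).toReal := fun s t hst =>
    ENNReal.toReal_mono (J_lt_top hβ hρ hξ t).ne (J_mono_state β hρ hξ hst)
  have hscale : ∀ s t : LiveState, s ≤ t →
      (J β ρ ξ t).toReal ≤ t / s * (J β ρ ξ s).toReal := by
    intro s t hst
    have h := ENNReal.toReal_mono (ENNReal.mul_ne_top ENNReal.ofReal_ne_top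
      (J_lt_top hβ hρ hξ s).ne) (J_le_mul_J β hρ hξ hst)
    rwa [ENNReal.toReal_mul, ENNReal.toReal_ofReal (div_nonneg t.2.1.le s.2.1.le)] at h
  refine continuous_iff_continuousAt.2 fun s => ?_
  have hs := s.2.1
  -- The `min` and `max` with 1 give one pair of bounds valid on both sides of `s`, combining
  -- monotonicity with the ratio bound.
  have hlow : Filter.Tendsto (fun t : LiveState => min 1 ((t : ℝ) / s) * (J β ρ ξ s).toReal)
      (nhds s) (nhds (J β ρ ξ s).toReal) := by
    have h : Continuous fun t : LiveState => min 1 ((t : ℝ) / s) * (J β ρ ξ s).toReal := by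
      fun_prop
    simpa [div_self hs.ne'] using h.tendsto s
  have hup : Filter.Tendsto (fun t : LiveState => max 1 ((t : ℝ) / s) * (J β ρ ξ s).toReal)
      (nhds s) (nhds (J β ρ ξ s).toReal) := by
    have h : Continuous fun t : LiveState => max 1 ((t : ℝ) / s) * (J β ρ ξ s).toReal := by
      fun_prop
    simpa [div_self hs.ne'] using h.tendsto s
  refine tendsto_of_tendsto_of_tendsto_of_le_of_le hlow hup (fun t => ?_) (fun t => ?_)
  · have ht := t.2.1
    have hJ : 0 ≤ (J β ρ ξ s).toReal := ENNReal.toReal_nonneg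
    rcases le_total s t with hst | hts
    · calc _ ≤ 1 * (J β ρ ξ s).toReal := by gcongr; exact min_le_left _ _
        _ ≤ _ := by simpa using hmono hst
    · calc _ ≤ (t : ℝ) / s * (J β ρ ξ s).toReal := by gcongr; exact min_le_right _ _
        _ ≤ (t : ℝ) / s * (s / t * (J β ρ ξ t).toReal) := by gcongr; exact hscale t s hts
        _ = _ := by field_simp
  · have hJ : 0 ≤ (J β ρ ξ s).toReal := ENNReal.toReal_nonneg
    rcases le_total s t with hst | hts
    · calc _ ≤ (t : ℝ) / s * (J β ρ ξ s).toReal := hscale s t hst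
        _ ≤ _ := by gcongr; exact le_max_right _ _
    · calc _ ≤ 1 * (J β ρ ξ s).toReal := by simpa using hmono hts
        _ ≤ _ := by gcongr; exact le_max_left _ _

theorem concaveOn_J_toReal {β ρ : ℝ} (hβ : 0 < β) (hρ : 0 ≤ ρ) (s : LiveState) :
    ConcaveOn ℝ (Set.Ioi 0) fun ξ : ℝ => (J β ρ ξ s).toReal := by
  refine ⟨convex_Ioi 0, fun ξ hξ η hη p q hp hq hpq => ?_⟩
  have hξ' : (0 : ℝ) ≤ ξ := le_of_lt hξ
  have hη' : (0 : ℝ) ≤ η := le_of_lt hη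
  have h := ENNReal.toReal_mono
    (J_lt_top hβ hρ (add_nonneg (mul_nonneg hp hξ') (mul_nonneg hq hη')) s).ne
    (J_concave_relayCost β hρ hξ' hη' hp hq hpq s)
  rwa [ENNReal.toReal_add (ENNReal.mul_ne_top ENNReal.ofReal_ne_top (J_lt_top hβ hρ hξ' s).ne)
    (ENNReal.mul_ne_top ENNReal.ofReal_ne_top (J_lt_top hβ hρ hη' s).ne), ENNReal.toReal_mul,
    ENNReal.toReal_mul, ENNReal.toReal_ofReal hp, ENNReal.toReal_ofReal hq] at h

end RelayPlacement

end

theorem mainTheorem11 (β ρ : ℝ) (hβ : 0 < β) (hρ : 0 < ρ) :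
    (∀ ξ : ℝ, 0 < ξ → ∀ s : RelayPlacement.LiveState, RelayPlacement.J β ρ ξ s < ⊤) ∧
    (∀ s : RelayPlacement.LiveState,
      MonotoneOn (fun ξ : ℝ => (RelayPlacement.J β ρ ξ s).toReal) (Set.Ioi 0) ∧
      ConcaveOn ℝ (Set.Ioi 0) (fun ξ : ℝ => (RelayPlacement.J β ρ ξ s).toReal)) ∧
    (∀ ξ : ℝ, 0 < ξ →
      Continuous (fun s : RelayPlacement.LiveState => (RelayPlacement.J β ρ ξ s).toReal)) ∧
    (∀ s : RelayPlacement.LiveState,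
      ContinuousOn (fun ξ : ℝ => (RelayPlacement.J β ρ ξ s).toReal) (Set.Ioi 0)) := by
  refine ⟨fun ξ hξ s => RelayPlacement.J_lt_top hβ hρ.le hξ.le s, fun s =>
    ⟨fun ξ _ η hη h => ENNReal.toReal_mono
      (RelayPlacement.J_lt_top hβ hρ.le (le_of_lt hη) s).ne
      (RelayPlacement.J_mono_relayCost β ρ s h), RelayPlacement.concaveOn_J_toReal hβ hρ.le s⟩,
    fun ξ hξ => RelayPlacement.continuous_J_toReal hβ hρ.le hξ.le, fun s =>
    (RelayPlacement.concaveOn_J_toReal hβ hρ.le s).continuousOn isOpen_Ioi⟩
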